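/- Let $R$ be a commutative ring in which $2$ is invertible, let $I$ be an ideal of $R$, let $n\ge 1$, and let $(P,\langle\,,\rangle)$ be a symplectic $R$-module of rank $2n$: $P$ is a finitely generated projective $R$-module of constant rank $2n$, and $\langle\,,\rangle$ is an alternating bilinear form on $P$ for which $x\mapsto\langle x,\cdot\rangle$ is an isomorphism $P\to P^*$. Let $\psi_n=\sum_{i=1}^n e_{2i-1,2i}-\sum_{i=1}^n e_{2i,2i-1}$, and assume that for every maximal ideal $\mathfrak m$ of $R$ the form induced by $\langle\,,\rangle$ on $P_{\mathfrak m}$ has, in some basis of the free $R_{\mathfrak m}$-module $P_{\mathfrak m}$, a matrix $\varphi_{\mathfrak m}\equiv\psi_n \pmod{I R_{\mathfrak m}}$. Let $Q=\mathbb H(R)\perp P$, that is, $R^2\oplus P$ with the form $\langle (a_1,b_1,p_1),(a_2,b_2,p_2)\rangle=a_1b_2-a_2b_1+\langle p_1,p_2\rangle$. Let $\mathrm{Trans}_{\mathrm{Sp}}(Q,IQ)$ be the group of automorphisms of $Q$ generated by the symplectic transvections $$\sigma(x)=x+\langle u,x\rangle v+\langle v,x\rangle u+\alpha\langle u,x\rangle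 u,\qquad u\in Q,\ v\in IQ,\ \alpha\in I,\ \langle u,v\rangle=0.$$ Let $\mathrm{ETrans}_{\mathrm{Sp}}(Q)$ be the group generated by the elementary symplectic transvections $$(a,b,p)\mapsto(a,\;b-\langle q,p\rangle+\alpha a,\;p+aq),\qquad (a,b,p)\mapsto(a+\langle q,p\rangle-\beta b,\;b,\;p+bq)$$ with $q\in P$ and $\alpha,\beta\in R$. Let $\mathrm{ETrans}_{\mathrm{Sp}}(IQ)$ be its subgroup generated by those with $q\in IP$ and $\alpha,\beta\in I$, and let $\mathrm{ETrans}_{\mathrm{Sp}}(Q,IQ)$ be the normal closure of $\mathrm{ETrans}_{\mathrm{Sp}}(IQ)$ in $\mathrm{ETrans}_{\mathrm{Sp}}(Q)$. Then $\mathrm{Trans}_{\mathrm{Sp}}(Q,IQ)=\mathrm{ETrans}_{\mathrm{Sp}}(Q,IQ)$. -/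

import Mathlib

open scoped TensorProduct

namespace SymplecticTransvection

section Forms

variable {R : Type*} [CommRing R]

/-- A form on `P` is symplectic: it is alternating, and `x ↦ ⟨x, ·⟩` is an isomorphism from `P`
onto its dual. -/
structure IsSymplecticForm {P : Type*} [AddCommGroup P] [Module R P]
    (B : LinearMap.BilinForm R P) : Prop where
  isAlt : B.IsAlt
  bijective : Function.Bijective (fun x : P => (B x : Module.Dual R P))

/-- The hyperbolic plane `ℍ(R)`, on the module `R²`:
`⟨(a₁, b₁), (a₂, b₂)⟩ = a₁ b₂ - a₂ b₁`. -/
def hyperbolicForm (R : Type*) [CommRing R] : LinearMap.BilinForm R (R × R) :=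
  LinearMap.mk₂ R (fun x y => x.1 * y.2 - y.1 * x.2)
    (fun x x' y => by simp only [Prod.fst_add, Prod.snd_add]; ring)
    (fun c x y => by simp only [Prod.smul_fst, Prod.smul_snd, smul_eq_mul]; ring)
    (fun x y y' => by simp only [Prod.fst_add, Prod.snd_add]; ring)
    (fun c x y => by simp only [Prod.smul_fst, Prod.smul_snd, smul_eq_mul]; ring)

/-- The orthogonal sum of two forms:
`⟨(p₁, p₂), (q₁, q₂)⟩ = ⟨p₁, q₁⟩₁ + ⟨p₂, q₂⟩₂`. -/
def orthogonalSum {M N : Type*} [AddCommGroup M] [Module R M] [AddCommGroup N] [Module R N]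
    (B₁ : LinearMap.BilinForm R M) (B₂ : LinearMap.BilinForm R N) :
    LinearMap.BilinForm R (M × N) :=
  B₁.compl₁₂ (LinearMap.fst R M N) (LinearMap.fst R M N) +
    B₂.compl₁₂ (LinearMap.snd R M N) (LinearMap.snd R M N)

/-- The form of `Q = ℍ(R) ⊥ P`, on the module `R² × P`. -/
def formQ {P : Type*} [AddCommGroup P] [Module R P] (B : LinearMap.BilinForm R P) :
    LinearMap.BilinForm R ((R × R) × P) :=
  orthogonalSum (hyperbolicForm R) B

/-- The standard alternating matrix `ψ_n = ∑ e_{2i-1,2i} - ∑ e_{2i,2i-1}`. The rows and columns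
are numbered from `0` here, so the entries `1` stand at `(2k, 2k+1)` and the entries `-1` at
`(2k+1, 2k)`. -/
def standardAlternating (n : ℕ) (A : Type*) [CommRing A] :
    Matrix (Fin (2 * n)) (Fin (2 * n)) A :=
  Matrix.of fun i j =>
    if i.val % 2 = 0 ∧ j.val = i.val + 1 then 1
    else if j.val % 2 = 0 ∧ i.val = j.val + 1 then -1
    else 0

/-- For every maximal ideal `𝔪` of `R`, the form that `B` induces on `P_𝔪 = R_𝔪 ⊗ P` has, in some
basis of `P_𝔪` with `2n` elements, a matrix that is congruent to `ψ_n` modulo `I R_𝔪`. -/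
def LocallyCongruentToStandard {P : Type*} [AddCommGroup P] [Module R P]
    (B : LinearMap.BilinForm R P) (n : ℕ) (I : Ideal R) : Prop :=
  ∀ (𝔪 : Ideal R) [𝔪.IsMaximal],
    ∃ b : Module.Basis (Fin (2 * n)) (Localization.AtPrime 𝔪) (Localization.AtPrime 𝔪 ⊗[R] P),
      ∀ i j : Fin (2 * n),
        LinearMap.BilinForm.baseChange (Localization.AtPrime 𝔪) B (b i) (b j)
            - standardAlternating n (Localization.AtPrime 𝔪) i j
          ∈ I.map (algebraMap R (Localization.AtPrime 𝔪))

end Forms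

section Groups

variable {R : Type*} [CommRing R]

/-- `σ` is the symplectic transvection
`p ↦ p + ⟨u, p⟩ v + ⟨v, p⟩ u + α ⟨u, p⟩ u`, where `⟨u, v⟩ = 0`. -/
def IsTransvectionOf {M : Type*} [AddCommGroup M] [Module R M] (B : LinearMap.BilinForm R M)
    (u v : M) (α : R) (σ : M ≃ₗ[R] M) : Prop :=
  B u v = 0 ∧ ∀ p : M, σ p = p + B u p • v + B v p • u + (α * B u p) • u

/-- The relative symplectic transvection group `Trans_Sp(M, IM)`: the group generated by the
symplectic transvections with `u ∈ M`, `v ∈ IM` and `α ∈ I`. -/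
def relTransSp {M : Type*} [AddCommGroup M] [Module R M] (B : LinearMap.BilinForm R M)
    (I : Ideal R) : Subgroup (M ≃ₗ[R] M) :=
  Subgroup.closure
    {σ | ∃ u v : M, ∃ α : R, v ∈ (I • ⊤ : Submodule R M) ∧ α ∈ I ∧ IsTransvectionOf B u v α σ}

variable {P : Type*} [AddCommGroup P] [Module R P]

/-- `σ` is the elementary symplectic transvection
`(a, b, p) ↦ (a, b - ⟨q, p⟩ + α a, p + a q)` of `Q`. -/
def IsLowerElementary (B : LinearMap.BilinForm R P) (q : P) (α : R)
    (σ : ((R × R) × P) ≃ₗ[R] ((R × R) × P)) : Prop :=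
  ∀ (a b : R) (p : P), σ ((a, b), p) = ((a, b - B q p + α * a), p + a • q)

/-- `σ` is the elementary symplectic transvection
`(a, b, p) ↦ (a + ⟨q, p⟩ - β b, b, p + b q)` of `Q`. -/
def IsUpperElementary (B : LinearMap.BilinForm R P) (q : P) (β : R)
    (σ : ((R × R) × P) ≃ₗ[R] ((R × R) × P)) : Prop :=
  ∀ (a b : R) (p : P), σ ((a, b), p) = ((a + B q p - β * b, b), p + b • q)

/-- The lower elementary maps are symplectic transvections of `Q`. -/
theorem IsLowerElementary.isTransvectionOf {B : LinearMap.BilinForm R P} {q : P} {α : R}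
    {σ : ((R × R) × P) ≃ₗ[R] ((R × R) × P)} (h : IsLowerElementary B q α σ) :
    IsTransvectionOf (formQ B) ((0, 1), 0) ((0, 0), -q) (-α) σ := by
  refine ⟨by simp [formQ, orthogonalSum, hyperbolicForm], ?_⟩
  rintro ⟨⟨a, b⟩, p⟩
  rw [h a b p]
  ext <;> simp [formQ, orthogonalSum, hyperbolicForm]
  ring

/-- The upper elementary maps are symplectic transvections of `Q`. -/
theorem IsUpperElementary.isTransvectionOf {B : LinearMap.BilinForm R P} {q : P} {β : R}
    {σ : ((R × R) × P) ≃ₗ[R] ((R × R) × P)} (h : IsUpperElementary B q β σ) :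
    IsTransvectionOf (formQ B) ((1, 0), 0) ((0, 0), q) (-β) σ := by
  refine ⟨by simp [formQ, orthogonalSum, hyperbolicForm], ?_⟩
  rintro ⟨⟨a, b⟩, p⟩
  rw [h a b p]
  ext <;> simp [formQ, orthogonalSum, hyperbolicForm]
  ring

/-- The group generated by the elementary symplectic transvections of `Q` whose parameters are
taken from `J` and `JP`. For `J = R` it is `ETrans_Sp(Q)`, for `J = I` it is `ETrans_Sp(IQ)`. -/
def elemTransSp (B : LinearMap.BilinForm R P) (J : Ideal R) :
    Subgroup (((R × R) × P) ≃ₗ[R] ((R × R) × P)) :=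
  Subgroup.closure
    {σ | ∃ q ∈ (J • ⊤ : Submodule R P), ∃ α ∈ J,
      IsLowerElementary B q α σ ∨ IsUpperElementary B q α σ}

/-- The relative elementary symplectic transvection group `ETrans_Sp(Q, IQ)`: the normal closure
of `ETrans_Sp(IQ)` in `ETrans_Sp(Q)`, as a group of automorphisms of `Q`. -/
def relElemTransSp (B : LinearMap.BilinForm R P) (I : Ideal R) :
    Subgroup (((R × R) × P) ≃ₗ[R] ((R × R) × P)) :=
  (Subgroup.normalClosure
    ((elemTransSp B I).subgroupOf (elemTransSp B ⊤) : Set (elemTransSp B (⊤ : Ideal R)))).map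
    (elemTransSp B ⊤).subtype

end Groups

end SymplecticTransvection

namespace SymplecticTransvection

open scoped commutatorElement

/-! ### Identities between symplectic transvections. -/

section Transvections

variable {R M : Type*} [CommRing R] [AddCommGroup M] [Module R M] {B : LinearMap.BilinForm R M}

/-! Write `σ_{u,v}` for a transvection with `α = 0`, and `τ_{w,c}` for `x ↦ x + c⟨w,x⟩w`. Since 2 is
invertible, every transvection with data `u, v, α` equals `τ_{u+v,1/2} τ_{u-v,-1/2} τ_{u,α}`
(`transvection_polarization`). The crux is `transvection_congruent`: `τ_{w,c}` lies in
`ETrans_Sp(Q)`, and its class modulo `ETrans_Sp(Q, IQ)` depends only on `w` and `c` modulo `I`. For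
`v ∈ IQ` and `α ∈ I` the product is then congruent to `τ_{u,1/2} τ_{u,-1/2} τ_{u,0} = 1`.

The crux holds because `τ_{w,c}` is a word in elementary transvections whose parameters respect
congruence modulo `I`. Splitting `w = e + p` with `e ∈ R²`, `p ∈ P` leaves `τ_{p,c}`, `σ_{e,cp}` and
`τ_{e,c}`. The first is a commutator of elementary transvections, the second reduces to these and
the first, and the third is a product of commutators of the second kind because the values of the
form on `P` generate `R` (`span_range_form_eq_top`).

The reverse inclusion holds because isometries conjugate transvections to transvections. -/

/-- The linear map underlying a symplectic transvection. -/
def transvectionMap (B : LinearMap.BilinForm R M) (u v : M) (α : R) : M →ₗ[R] M :=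
  LinearMap.id + (B u).smulRight v + (B v).smulRight u + (α • B u).smulRight u

theorem transvectionMap_apply (u v : M) (α : R) (x : M) :
    transvectionMap B u v α x = x + B u x • v + B v x • u + (α * B u x) • u := by
  simp [transvectionMap]

/-- For fixed `u` the transvections compose as in a Heisenberg group, with cocycle `B v v'`. -/
theorem transvectionMap_comp (hB : B.IsAlt) {u v v' : M} (α α' : R) (h : B u v = 0)
    (h' : B u v' = 0) (x : M) :
    transvectionMap B u v α (transvectionMap B u v' α' x) =
      transvectionMap B u (v + v') (α + α' + B v v') x := by
  have hvu : B v u = 0 := hB.isRefl _ _ h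
  simp only [transvectionMap_apply, map_add, map_smul, LinearMap.add_apply, h', hvu,
    hB.self_eq_zero]
  module

theorem transvectionMap_zero (u x : M) : transvectionMap B u 0 0 x = x := by
  simp [transvectionMap_apply]

/-- The symplectic transvection `x ↦ x + ⟨u, x⟩ v + ⟨v, x⟩ u + α ⟨u, x⟩ u`, for `⟨u, v⟩ = 0`. -/
def transvection (hB : B.IsAlt) (u v : M) (α : R) (h : B u v = 0) : M ≃ₗ[R] M :=
  LinearEquiv.ofLinearMap (transvectionMap B u v α) (transvectionMap B u (-v) (-α))
    (LinearMap.ext fun x => by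
      rw [LinearMap.comp_apply, transvectionMap_comp hB _ _ h (by simp [h])]
      simp [hB.self_eq_zero, transvectionMap_zero])
    (LinearMap.ext fun x => by
      rw [LinearMap.comp_apply, transvectionMap_comp hB _ _ (by simp [h]) h]
      simp [hB.self_eq_zero, transvectionMap_zero])

theorem transvection_apply (hB : B.IsAlt) (u v : M) (α : R) (h : B u v = 0) (x : M) :
    transvection hB u v α h x = x + B u x • v + B v x • u + (α * B u x) • u :=
  transvectionMap_apply u v α x

theorem isTransvectionOf_iff (hB : B.IsAlt) {u v : M} {α : R} {σ : M ≃ₗ[R] M} :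
    IsTransvectionOf B u v α σ ↔ ∃ h : B u v = 0, σ = transvection hB u v α h := by
  refine ⟨fun h => ⟨h.1, LinearEquiv.ext fun x => ?_⟩, ?_⟩
  · rw [h.2, transvection_apply]
  · rintro ⟨h, rfl⟩
    exact ⟨h, transvection_apply hB u v α h⟩

theorem transvection_mul (hB : B.IsAlt) {u v v' : M} (α α' : R) (h : B u v = 0)
    (h' : B u v' = 0) :
    transvection hB u v α h * transvection hB u v' α' h' =
      transvection hB u (v + v') (α + α' + B v v') (by simp [h, h']) :=
  LinearEquiv.ext fun x => transvectionMap_comp hB α α' h h' x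

theorem transvection_zero (hB : B.IsAlt) (u : M) :
    transvection hB u 0 0 (map_zero _) = 1 :=
  LinearEquiv.ext fun x => transvectionMap_zero u x

theorem transvection_inv (hB : B.IsAlt) {u v : M} (α : R) (h : B u v = 0) :
    (transvection hB u v α h)⁻¹ = transvection hB u (-v) (-α) (by simp [h]) := by
  rw [inv_eq_iff_mul_eq_one, transvection_mul]
  simp [hB.self_eq_zero, transvection_zero]

theorem transvection_isometry (hB : B.IsAlt) {u v : M} (α : R) (h : B u v = 0) (x y : M) :
    B (transvection hB u v α h x) (transvection hB u v α h y) = B x y := by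
  have hvu : B v u = 0 := hB.isRefl _ _ h
  have hx := hB.neg_eq x u
  have hx' := hB.neg_eq x v
  simp only [transvection_apply, map_add, map_smul, LinearMap.add_apply, LinearMap.smul_apply, h,
    hvu, hB.self_eq_zero, smul_eq_mul, ← hx, ← hx']
  ring

theorem transvection_conj (hB : B.IsAlt) {u v : M} (α : R) (h : B u v = 0) {g : M ≃ₗ[R] M}
    (hg : ∀ x y, B (g x) (g y) = B x y) :
    g * transvection hB u v α h * g⁻¹ = transvection hB (g u) (g v) α (by rw [hg, h]) := by
  rw [mul_inv_eq_iff_eq_mul]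
  ext x
  simp only [LinearEquiv.mul_apply, transvection_apply, map_add, map_smul, hg]

/-- `τ_q` is a commutator of transvections along the two vectors of a hyperbolic pair. -/
theorem commutator_transvection_hyperbolic (hB : B.IsAlt) {e f q : M} (hef : B e f = 1)
    (heq : B e q = 0) (hfq : B f q = 0) (c : R) :
    ⁅transvection hB e q 0 heq, transvection hB f (c • q) 0 (by simp [hfq])⁆ =
      transvection hB q 0 (2 * c) (map_zero _) := by
  have hfe : B f e = -1 := by rw [← hef]; exact (hB.neg_eq e f).symm
  have hqe : B q e = 0 := hB.isRefl _ _ heq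
  have hqf : B q f = 0 := hB.isRefl _ _ hfq
  -- Conceptually, `σ_{e,q}` fixes `q` and sends `f` to `f + q`, so it conjugates `σ_{f,cq}` to
  -- `σ_{f+q,cq} = τ_{q,2c} σ_{f,cq}`.
  rw [commutatorElement_def, mul_inv_eq_iff_eq_mul, mul_inv_eq_iff_eq_mul]
  ext x
  simp only [LinearEquiv.mul_apply, transvection_apply, map_add, map_smul, LinearMap.smul_apply,
    smul_eq_mul, hef, hfe, heq, hfq, hqe, hqf, hB.self_eq_zero, map_zero, LinearMap.zero_apply]
  module

/-- The two factors along `e` and `f` do not commute; the last factor cancels the cross term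
`ab⟨q,x⟩q` produced by `⟨e,f⟩ = 1`. -/
theorem transvection_hyperbolic (hB : B.IsAlt) {e f q : M} (hef : B e f = 1)
    (heq : B e q = 0) (hfq : B f q = 0) (a b : R) :
    transvection hB (a • e + b • f) q 0 (by simp [heq, hfq]) =
      transvection hB e (a • q) 0 (by simp [heq]) * transvection hB f (b • q) 0 (by simp [hfq]) *
        transvection hB q 0 (-(a * b)) (map_zero _) := by
  have hqf : B q f = 0 := hB.isRefl _ _ hfq
  ext x
  simp only [LinearEquiv.mul_apply, transvection_apply, map_add, map_smul, LinearMap.smul_apply,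
    LinearMap.add_apply,
    smul_eq_mul, hef, heq, hfq, hqf, hB.self_eq_zero, map_zero, LinearMap.zero_apply]
  module

/-- This is the commutator in the Heisenberg group along `e`: twice the cocycle, hence central. -/
theorem commutator_transvection_same (hB : B.IsAlt) {e p q : M} (hp : B e p = 0)
    (hq : B e q = 0) :
    ⁅transvection hB e p 0 hp, transvection hB e q 0 hq⁆ =
      transvection hB e 0 (2 * B p q) (map_zero _) := by
  rw [commutatorElement_def, mul_inv_eq_iff_eq_mul, mul_inv_eq_iff_eq_mul, transvection_mul,
    transvection_mul, transvection_mul]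
  have hqp := hB.neg_eq q p
  ext x
  simp only [transvection_apply, map_add, LinearMap.add_apply, map_zero, LinearMap.zero_apply,
    ← hqp]
  module

/-- As `e` and `p` are orthogonal, the corrections simply add up; `σ_{e,cp}` supplies the mixed
terms of `c⟨e+p,x⟩(e+p)`. -/
theorem transvection_add_left (hB : B.IsAlt) {e p : M} (h : B e p = 0) (c : R) :
    transvection hB (e + p) 0 c (map_zero _) =
      transvection hB e 0 c (map_zero _) * transvection hB p 0 c (map_zero _) *
        transvection hB e (c • p) 0 (by simp [h]) := by
  have hpe : B p e = 0 := hB.isRefl _ _ h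
  ext x
  simp only [LinearEquiv.mul_apply, transvection_apply, map_add, map_smul, LinearMap.smul_apply,
    LinearMap.add_apply, smul_eq_mul, h, hpe, hB.self_eq_zero, map_zero, LinearMap.zero_apply]
  module

/-- The difference of the squares of `u + v` and `u - v` is twice the mixed term, and orthogonality
of `u` and `v` turns the sum into a composite. -/
theorem transvection_polarization (hB : B.IsAlt) {u v : M} (h : B u v = 0) (α : R) {c : R}
    (hc : 2 * c = 1) :
    transvection hB u v α h =
      transvection hB (u + v) 0 c (map_zero _) * transvection hB (u - v) 0 (-c) (map_zero _) *
        transvection hB u 0 α (map_zero _) := by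
  have hvu : B v u = 0 := hB.isRefl _ _ h
  ext x
  simp only [LinearEquiv.mul_apply, transvection_apply, map_add, map_smul, map_sub,
    LinearMap.add_apply, LinearMap.sub_apply, h, hvu, hB.self_eq_zero, map_zero,
    LinearMap.zero_apply]
  linear_combination (norm := module) (-hc) • (B u x • v + B v x • u)

end Transvections

/-! ### Congruence modulo a normal subgroup. -/

section CongruentPairs

variable {A : Type*} [Group A] {G : Subgroup A}

/-- The pairs of elements of `G` that are congruent modulo a normal subgroup `N` of `G`. -/
def congruentPairs (N : Subgroup G) [N.Normal] : Subgroup (A × A) :=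
  (MonoidHom.eqLocus ((QuotientGroup.mk' N).comp (MonoidHom.fst G G))
    ((QuotientGroup.mk' N).comp (MonoidHom.snd G G))).map (G.subtype.prodMap G.subtype)

/-- Packaging congruence as a subgroup of `A × A` makes its compatibility with products, inverses
and commutators automatic. -/
theorem mem_congruentPairs {N : Subgroup G} [N.Normal] {a b : A} :
    (a, b) ∈ congruentPairs N ↔ a ∈ G ∧ a⁻¹ * b ∈ N.map G.subtype := by
  constructor
  · rintro ⟨⟨x, y⟩, hxy, h⟩
    obtain ⟨rfl, rfl⟩ := Prod.ext_iff.1 h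
    exact ⟨x.2, ⟨x⁻¹ * y, QuotientGroup.eq.1 hxy, rfl⟩⟩
  · rintro ⟨ha, z, hz, h⟩
    refine ⟨(⟨a, ha⟩, ⟨a, ha⟩ * z), ?_, ?_⟩
    · exact QuotientGroup.eq.2 (by simpa using hz)
    · ext
      · rfl
      · simp only [MonoidHom.prodMap_def, Subgroup.subtype_apply] at h ⊢
        simp [h]

end CongruentPairs

/-! ### Congruences modulo an ideal. -/

section ModIdeal

variable {R M : Type*} [CommRing R] [AddCommGroup M] [Module R M] {I : Ideal R}

theorem apply_mem_of_mem_smul_top (f : M →ₗ[R] R) {x : M} (hx : x ∈ (I • ⊤ : Submodule R M)) :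
    f x ∈ I := by
  have := Submodule.smul_top_le_comap_smul_top I f hx
  simpa using this

theorem smul_sub_smul_mem {a a' : R} {x x' : M} (ha : a - a' ∈ I)
    (hx : x - x' ∈ (I • ⊤ : Submodule R M)) : a • x - a' • x' ∈ (I • ⊤ : Submodule R M) := by
  have : a • x - a' • x' = a • (x - x') + (a - a') • x' := by module
  rw [this]
  exact add_mem (Submodule.smul_mem _ _ hx) (Submodule.smul_mem_smul ha trivial)

theorem mul_sub_mul_mem {a a' b b' : R} (ha : a - a' ∈ I) (hb : b - b' ∈ I) :
    a * b - a' * b' ∈ I := by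
  have : a * b - a' * b' = a * (b - b') + b' * (a - a') := by ring
  rw [this]
  exact add_mem (I.mul_mem_left _ hb) (I.mul_mem_left _ ha)

end ModIdeal

/-! ### The values of the form generate the unit ideal. -/

section Unimodular

variable {R P : Type*} [CommRing R] [AddCommGroup P] [Module R P]

/-- The values of a form that represents every functional on a projective module of positive rank
generate the unit ideal. -/
theorem span_range_form_eq_top [Module.Finite R P] [Module.Projective R P]
    (hrank : ∀ 𝔭 : PrimeSpectrum R, 0 < Module.rankAtStalk (R := R) P 𝔭)
    {B : LinearMap.BilinForm R P}
    (hB : Function.Surjective (fun x : P => (B x : Module.Dual R P))) :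
    Ideal.span (Set.range fun x : P × P => B x.1 x.2) = ⊤ := by
  by_contra hJ
  obtain ⟨𝔪, h𝔪, hle⟩ := Ideal.exists_le_maximal _ hJ
  obtain ⟨s, hs⟩ := Module.projective_def'.1 ‹Module.Projective R P›
  -- The section `s` gives dual-basis coordinates. Each is a functional `B x`, so takes values in
  -- `𝔪`.
  have hP : (⊤ : Submodule R P) ≤ 𝔪 • ⊤ := by
    intro p _
    rw [← LinearMap.id_apply (R := R) p, ← hs, LinearMap.comp_apply,
      Finsupp.linearCombination_apply]
    refine Submodule.sum_mem _ fun m _ => Submodule.smul_mem_smul (hle ?_) trivial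
    obtain ⟨x, hx⟩ := hB ((Finsupp.lapply m).comp s)
    exact Ideal.subset_span ⟨(x, p), LinearMap.congr_fun hx p⟩
  -- By Nakayama some `r ≡ 1` modulo `𝔪` kills `P`, contradicting positive rank at `𝔪`.
  obtain ⟨r, hr, hr'⟩ := Submodule.exists_sub_one_mem_and_smul_eq_zero_of_fg_of_le_smul 𝔪 ⊤
    Module.Finite.fg_top hP
  obtain ⟨m, hm⟩ := Module.mem_support_iff'.1
    ((Module.rankAtStalk_pos_iff_mem_support _).1 (hrank ⟨𝔪, h𝔪.isPrime⟩))
  refine hm r (fun hr0 => h𝔪.ne_top ((Ideal.eq_top_iff_one _).2 ?_)) (hr' m trivial)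
  simpa using sub_mem hr0 hr

end Unimodular

/-! ### Elementary transvections of the hyperbolic sum. -/

section HyperbolicSum

variable {R P : Type*} [CommRing R] [AddCommGroup P] [Module R P] {B : LinearMap.BilinForm R P}

theorem formQ_apply (a b a' b' : R) (p p' : P) :
    formQ B ((a, b), p) ((a', b'), p') = a * b' - a' * b + B p p' := by
  simp [formQ, orthogonalSum, hyperbolicForm]

theorem formQ_isAlt (hB : B.IsAlt) : (formQ B).IsAlt := by
  rintro ⟨⟨a, b⟩, p⟩
  rw [formQ_apply, hB.self_eq_zero]
  ring

theorem isUpperElementary_iff (hB : B.IsAlt) {q : P} {β : R}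
    {σ : ((R × R) × P) ≃ₗ[R] ((R × R) × P)} :
    IsUpperElementary B q β σ ↔
      σ = transvection (formQ_isAlt hB) ((1, 0), 0) ((0, 0), q) (-β) (by simp [formQ_apply]) := by
  refine ⟨fun h => ((isTransvectionOf_iff (formQ_isAlt hB)).1 h.isTransvectionOf).2, ?_⟩
  rintro rfl a b p
  rw [transvection_apply, formQ_apply, formQ_apply]
  ext <;> simp
  ring

theorem isLowerElementary_iff (hB : B.IsAlt) {q : P} {α : R}
    {σ : ((R × R) × P) ≃ₗ[R] ((R × R) × P)} :
    IsLowerElementary B q α σ ↔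
      σ = transvection (formQ_isAlt hB) ((0, 1), 0) ((0, 0), -q) (-α)
        (by simp [formQ_apply]) := by
  refine ⟨fun h => ((isTransvectionOf_iff (formQ_isAlt hB)).1 h.isTransvectionOf).2, ?_⟩
  rintro rfl a b p
  rw [transvection_apply, formQ_apply, formQ_apply]
  ext <;> simp
  ring

theorem upper_mem_elemTransSp (hB : B.IsAlt) {J : Ideal R} {q : P} {β : R}
    (hq : q ∈ (J • ⊤ : Submodule R P)) (hβ : β ∈ J) :
    transvection (formQ_isAlt hB) ((1, 0), 0) ((0, 0), q) β (by simp [formQ_apply]) ∈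
      elemTransSp B J :=
  Subgroup.subset_closure
    ⟨q, hq, -β, neg_mem hβ, Or.inr ((isUpperElementary_iff hB).2 (by simp only [neg_neg]))⟩

theorem lower_mem_elemTransSp (hB : B.IsAlt) {J : Ideal R} {q : P} {α : R}
    (hq : q ∈ (J • ⊤ : Submodule R P)) (hα : α ∈ J) :
    transvection (formQ_isAlt hB) ((0, 1), 0) ((0, 0), q) α (by simp [formQ_apply]) ∈
      elemTransSp B J :=
  Subgroup.subset_closure
    ⟨-q, neg_mem hq, -α, neg_mem hα, Or.inl ((isLowerElementary_iff hB).2 (by simp only [neg_neg]))⟩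

/-! ### Elementary groups inside transvection groups. -/

theorem elemTransSp_le_relTransSp (J : Ideal R) :
    elemTransSp B J ≤ relTransSp (formQ B) J := by
  refine (Subgroup.closure_le _).2 ?_
  rintro σ ⟨q, hq, α, hα, h | h⟩
  · exact Subgroup.subset_closure ⟨_, _, _, Submodule.smul_top_le_comap_smul_top J
      (LinearMap.inr R (R × R) P) (neg_mem hq), neg_mem hα, h.isTransvectionOf⟩
  · exact Subgroup.subset_closure ⟨_, _, _, Submodule.smul_top_le_comap_smul_top J
      (LinearMap.inr R (R × R) P) hq, neg_mem hα, h.isTransvectionOf⟩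

theorem elemTransSp_mono {J K : Ideal R} (h : J ≤ K) : elemTransSp B J ≤ elemTransSp B K :=
  Subgroup.closure_mono fun _ ⟨q, hq, α, hα, hσ⟩ =>
    ⟨q, Submodule.smul_mono_left h hq, α, h hα, hσ⟩

theorem relTransSp_isometry {M : Type*} [AddCommGroup M] [Module R M] {B : LinearMap.BilinForm R M}
    (hB : B.IsAlt) {J : Ideal R} {g : M ≃ₗ[R] M} (hg : g ∈ relTransSp B J) (x y : M) :
    B (g x) (g y) = B x y := by
  induction hg using Subgroup.closure_induction generalizing x y with
  | mem g hg =>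
    obtain ⟨u, v, α, -, -, h⟩ := hg
    obtain ⟨huv, rfl⟩ := (isTransvectionOf_iff hB).1 h
    exact transvection_isometry hB α huv x y
  | one => rfl
  | mul g h _ _ ihg ihh => rw [LinearEquiv.mul_apply, LinearEquiv.mul_apply, ihg, ihh]
  | inv g _ ih =>
    rw [← ih, ← LinearEquiv.mul_apply, ← LinearEquiv.mul_apply, mul_inv_cancel]
    rfl

theorem conj_mem_relTransSp {M : Type*} [AddCommGroup M] [Module R M]
    {B : LinearMap.BilinForm R M} (hB : B.IsAlt) {J : Ideal R} {g σ : M ≃ₗ[R] M}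
    (hg : ∀ x y, B (g x) (g y) = B x y) (hσ : σ ∈ relTransSp B J) :
    g * σ * g⁻¹ ∈ relTransSp B J := by
  induction hσ using Subgroup.closure_induction with
  | mem σ hσ =>
    obtain ⟨u, v, α, hv, hα, h⟩ := hσ
    obtain ⟨huv, rfl⟩ := (isTransvectionOf_iff hB).1 h
    rw [transvection_conj hB α huv hg]
    exact Subgroup.subset_closure ⟨g u, g v, α,
      Submodule.smul_top_le_comap_smul_top J g.toLinearMap hv, hα,
      (isTransvectionOf_iff hB).2 ⟨_, rfl⟩⟩
  | one => simp
  | mul σ τ _ _ ihσ ihτ =>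
    have : g * (σ * τ) * g⁻¹ = g * σ * g⁻¹ * (g * τ * g⁻¹) := by group
    rw [this]
    exact mul_mem ihσ ihτ
  | inv σ _ ih =>
    have : g * σ⁻¹ * g⁻¹ = (g * σ * g⁻¹)⁻¹ := by group
    rw [this]
    exact inv_mem ih

theorem relElemTransSp_le_relTransSp (hB : B.IsAlt) (I : Ideal R) :
    relElemTransSp B I ≤ relTransSp (formQ B) I := by
  have hQ := formQ_isAlt hB
  let N := (relTransSp (formQ B) I).subgroupOf (elemTransSp B ⊤)
  have : N.Normal := ⟨fun σ hσ g => conj_mem_relTransSp hQ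
    (relTransSp_isometry hQ (elemTransSp_le_relTransSp ⊤ g.2)) hσ⟩
  have hN : Subgroup.normalClosure
      ((elemTransSp B I).subgroupOf (elemTransSp B ⊤) : Set (elemTransSp B (⊤ : Ideal R))) ≤ N :=
    Subgroup.normalClosure_le_normal fun σ hσ => elemTransSp_le_relTransSp I hσ
  rintro _ ⟨σ, hσ, rfl⟩
  exact hN hσ

theorem elemTransSp_le_relElemTransSp (I : Ideal R) : elemTransSp B I ≤ relElemTransSp B I :=
  fun σ hσ => ⟨⟨σ, elemTransSp_mono le_top hσ⟩, Subgroup.subset_normalClosure hσ, rfl⟩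

/-! ### Transvections modulo the relative elementary group. -/

variable (B) in
/-- Congruence of elements of `ETrans_Sp(Q)` modulo `ETrans_Sp(Q, IQ)`. -/
def ElemCongr (I : Ideal R) (σ τ : ((R × R) × P) ≃ₗ[R] ((R × R) × P)) : Prop :=
  (σ, τ) ∈ congruentPairs (Subgroup.normalClosure
    ((elemTransSp B I).subgroupOf (elemTransSp B ⊤) : Set (elemTransSp B (⊤ : Ideal R))))

theorem elemCongr_iff {I : Ideal R} {σ τ : ((R × R) × P) ≃ₗ[R] ((R × R) × P)} :
    ElemCongr B I σ τ ↔ σ ∈ elemTransSp B ⊤ ∧ σ⁻¹ * τ ∈ relElemTransSp B I :=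
  mem_congruentPairs

theorem ElemCongr.one (I : Ideal R) : ElemCongr B I 1 1 :=
  Subgroup.one_mem _

theorem ElemCongr.mul {I : Ideal R} {σ τ σ' τ' : ((R × R) × P) ≃ₗ[R] ((R × R) × P)}
    (h : ElemCongr B I σ τ) (h' : ElemCongr B I σ' τ') : ElemCongr B I (σ * σ') (τ * τ') :=
  Subgroup.mul_mem _ h h'

theorem ElemCongr.inv {I : Ideal R} {σ τ : ((R × R) × P) ≃ₗ[R] ((R × R) × P)}
    (h : ElemCongr B I σ τ) : ElemCongr B I σ⁻¹ τ⁻¹ :=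
  Subgroup.inv_mem _ h

theorem ElemCongr.commutator {I : Ideal R} {σ τ σ' τ' : ((R × R) × P) ≃ₗ[R] ((R × R) × P)}
    (h : ElemCongr B I σ τ) (h' : ElemCongr B I σ' τ') : ElemCongr B I ⁅σ, σ'⁆ ⁅τ, τ'⁆ :=
  ((h.mul h').mul h.inv).mul h'.inv

variable {I : Ideal R}

theorem upper_congruent (hB : B.IsAlt) {q q' : P} (hq : q - q' ∈ (I • ⊤ : Submodule R P)) :
    ElemCongr B I (transvection (formQ_isAlt hB) ((1, 0), 0) ((0, 0), q) 0 (by simp [formQ_apply]))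
      (transvection (formQ_isAlt hB) ((1, 0), 0) ((0, 0), q') 0 (by simp [formQ_apply])) := by
  refine elemCongr_iff.2 ⟨upper_mem_elemTransSp hB (by simp) trivial, ?_⟩
  have hq' : q' - q ∈ (I • ⊤ : Submodule R P) := by simpa using neg_mem hq
  -- The quotient has scalar `-⟨q,q'⟩`, which lies in `I` because it equals `-⟨q,q'-q⟩`.
  have := elemTransSp_le_relElemTransSp I (upper_mem_elemTransSp hB hq'
    (neg_mem (apply_mem_of_mem_smul_top (B q) hq')))
  rw [transvection_inv, transvection_mul]
  convert this using 2
  · simp [sub_eq_neg_add]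
  · simp [formQ_apply, hB.self_eq_zero]

theorem lower_congruent (hB : B.IsAlt) {q q' : P} (hq : q - q' ∈ (I • ⊤ : Submodule R P)) :
    ElemCongr B I (transvection (formQ_isAlt hB) ((0, 1), 0) ((0, 0), q) 0 (by simp [formQ_apply]))
      (transvection (formQ_isAlt hB) ((0, 1), 0) ((0, 0), q') 0 (by simp [formQ_apply])) := by
  refine elemCongr_iff.2 ⟨lower_mem_elemTransSp hB (by simp) trivial, ?_⟩
  have hq' : q' - q ∈ (I • ⊤ : Submodule R P) := by simpa using neg_mem hq
  have := elemTransSp_le_relElemTransSp I (lower_mem_elemTransSp hB hq'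
    (neg_mem (apply_mem_of_mem_smul_top (B q) hq')))
  rw [transvection_inv, transvection_mul]
  convert this using 2
  · simp [sub_eq_neg_add]
  · simp [formQ_apply, hB.self_eq_zero]

/-- The class of `τ_{q, c}`, for `q ∈ P`, depends only on `q` and `c` modulo `I`. -/
theorem transvection_inr_congruent (hB : B.IsAlt) {h : R} (h2 : 2 * h = 1) {q q' : P} {c c' : R}
    (hq : q - q' ∈ (I • ⊤ : Submodule R P)) (hc : c - c' ∈ I) :
    ElemCongr B I (transvection (formQ_isAlt hB) ((0, 0), q) 0 c (map_zero _))
      (transvection (formQ_isAlt hB) ((0, 0), q') 0 c' (map_zero _)) := by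
  have key (q : P) (c : R) : transvection (formQ_isAlt hB) ((0, 0), q) 0 c (map_zero _) =
      ⁅transvection (formQ_isAlt hB) ((1, 0), 0) ((0, 0), q) 0 (by simp [formQ_apply]),
        transvection (formQ_isAlt hB) ((0, 1), 0) ((0, 0), (h * c) • q) 0
          (by simp [formQ_apply])⁆ := by
    have hc : 2 * (h * c) = c := by rw [← mul_assoc, h2, one_mul]
    have := commutator_transvection_hyperbolic (formQ_isAlt hB) (e := ((1, 0), 0))
      (f := ((0, 1), 0)) (q := ((0, 0), q)) (by simp [formQ_apply]) (by simp [formQ_apply])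
      (by simp [formQ_apply]) (h * c)
    simp only [hc] at this
    rw [← this]
    simp
  rw [key q c, key q' c']
  have hX := upper_congruent hB hq
  have hY := lower_congruent hB
    (smul_sub_smul_mem (mul_sub_mul_mem (a := h) (a' := h) (by simp) hc) hq)
  exact hX.commutator hY

/-- The class of `σ_{e, q}`, for `e ∈ R²` and `q ∈ P`, depends only on `e` and `q` modulo `I`. -/
theorem transvection_inl_inr_congruent (hB : B.IsAlt) {h : R} (h2 : 2 * h = 1)
    {a a' b b' : R} {q q' : P} (ha : a - a' ∈ I) (hb : b - b' ∈ I)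
    (hq : q - q' ∈ (I • ⊤ : Submodule R P)) :
    ElemCongr B I (transvection (formQ_isAlt hB) ((a, b), 0) ((0, 0), q) 0 (by simp [formQ_apply]))
      (transvection (formQ_isAlt hB) ((a', b'), 0) ((0, 0), q') 0 (by simp [formQ_apply])) := by
  have key (a b : R) (q : P) :
      transvection (formQ_isAlt hB) ((a, b), 0) ((0, 0), q) 0 (by simp [formQ_apply]) =
      transvection (formQ_isAlt hB) ((1, 0), 0) ((0, 0), a • q) 0 (by simp [formQ_apply]) *
      transvection (formQ_isAlt hB) ((0, 1), 0) ((0, 0), b • q) 0 (by simp [formQ_apply]) *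
      transvection (formQ_isAlt hB) ((0, 0), q) 0 (-(a * b)) (map_zero _) := by
    have := transvection_hyperbolic (formQ_isAlt hB) (e := ((1, 0), 0))
      (f := ((0, 1), 0)) (q := ((0, 0), q)) (by simp [formQ_apply]) (by simp [formQ_apply])
      (by simp [formQ_apply]) a b
    simpa using this
  rw [key a b q, key a' b' q']
  refine ((upper_congruent hB (smul_sub_smul_mem ha hq)).mul
    (lower_congruent hB (smul_sub_smul_mem hb hq))).mul (transvection_inr_congruent hB h2 hq ?_)
  have := neg_mem (mul_sub_mul_mem ha hb)
  rwa [neg_sub, ← neg_sub_neg] at this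

/-- The class of `τ_{e, c}`, for `e ∈ R²`, depends only on `e` and `c` modulo `I`. -/
theorem transvection_inl_congruent (hB : B.IsAlt)
    (hspan : Ideal.span (Set.range fun x : P × P => B x.1 x.2) = ⊤) {h : R} (h2 : 2 * h = 1)
    {a a' b b' : R} {c c' : R} (ha : a - a' ∈ I) (hb : b - b' ∈ I) (hc : c - c' ∈ I) :
    ElemCongr B I (transvection (formQ_isAlt hB) ((a, b), 0) 0 c (map_zero _))
      (transvection (formQ_isAlt hB) ((a', b'), 0) 0 c' (map_zero _)) := by
  -- The case `r = 1` is the goal. Keeping `c` and `c'` general lets the induction absorb a scalar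
  -- multiple of `r` into them.
  suffices H : ∀ r ∈ Ideal.span (Set.range fun x : P × P => B x.1 x.2), ∀ c c' : R, c - c' ∈ I →
      ElemCongr B I (transvection (formQ_isAlt hB) ((a, b), 0) 0 (c * r) (map_zero _))
        (transvection (formQ_isAlt hB) ((a', b'), 0) 0 (c' * r) (map_zero _)) by
    simpa using H 1 (by simp [hspan]) c c' hc
  intro r hr
  induction hr using Submodule.span_induction with
  | mem r hr =>
    obtain ⟨⟨p, q⟩, rfl⟩ := hr
    intro c c' hc
    have key (a b c : R) :
        transvection (formQ_isAlt hB) ((a, b), 0) 0 (c * B p q) (map_zero _) =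
        ⁅transvection (formQ_isAlt hB) ((a, b), 0) ((0, 0), p) 0 (by simp [formQ_apply]),
          transvection (formQ_isAlt hB) ((a, b), 0) ((0, 0), (h * c) • q) 0
            (by simp [formQ_apply])⁆ := by
      have hc : 2 * (h * c * B p q) = c * B p q := by linear_combination c * B p q * h2
      rw [commutator_transvection_same]
      simp only [formQ_apply, map_smul, smul_eq_mul, mul_zero, sub_zero, zero_add, hc]
    have hp := transvection_inl_inr_congruent hB h2 ha hb (q := p) (q' := p) (by simp)
    have hq := transvection_inl_inr_congruent hB h2 ha hb
      (smul_sub_smul_mem (mul_sub_mul_mem (a := h) (a' := h) (by simp) hc)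
        (x := q) (x' := q) (by simp))
    rw [key, key]
    exact hp.commutator hq
  | zero =>
    intro c c' _
    simp only [mul_zero, transvection_zero]
    exact .one I
  | add r s _ _ ihr ihs =>
    intro c c' hc
    have := (ihr c c' hc).mul (ihs c c' hc)
    rw [transvection_mul, transvection_mul] at this
    simpa [mul_add] using this
  | smul d r _ ih =>
    intro c c' hc
    have := ih (c * d) (c' * d) (mul_sub_mul_mem hc (by simp))
    simpa [mul_assoc] using this

/-- The class of `τ_{w, c}`, for `w ∈ Q`, depends only on `w` and `c` modulo `I`. -/
theorem transvection_congruent (hB : B.IsAlt)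
    (hspan : Ideal.span (Set.range fun x : P × P => B x.1 x.2) = ⊤) {h : R} (h2 : 2 * h = 1)
    {w w' : (R × R) × P} {c c' : R} (hw : w - w' ∈ (I • ⊤ : Submodule R ((R × R) × P)))
    (hc : c - c' ∈ I) :
    ElemCongr B I (transvection (formQ_isAlt hB) w 0 c (map_zero _))
      (transvection (formQ_isAlt hB) w' 0 c' (map_zero _)) := by
  obtain ⟨⟨a, b⟩, p⟩ := w
  obtain ⟨⟨a', b'⟩, p'⟩ := w'
  have ha : a - a' ∈ I :=
    apply_mem_of_mem_smul_top (LinearMap.fst R R R ∘ₗ LinearMap.fst R (R × R) P) hw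
  have hb : b - b' ∈ I :=
    apply_mem_of_mem_smul_top (LinearMap.snd R R R ∘ₗ LinearMap.fst R (R × R) P) hw
  have hp : p - p' ∈ (I • ⊤ : Submodule R P) :=
    Submodule.smul_top_le_comap_smul_top I (LinearMap.snd R (R × R) P) hw
  have key (a b c : R) (p : P) :
      transvection (formQ_isAlt hB) ((a, b), p) 0 c (map_zero _) =
      transvection (formQ_isAlt hB) ((a, b), 0) 0 c (map_zero _) *
      transvection (formQ_isAlt hB) ((0, 0), p) 0 c (map_zero _) *
      transvection (formQ_isAlt hB) ((a, b), 0) ((0, 0), c • p) 0 (by simp [formQ_apply]) := by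
    have := transvection_add_left (formQ_isAlt hB) (e := ((a, b), 0)) (p := ((0, 0), p))
      (by simp [formQ_apply]) c
    simpa using this
  rw [key, key a']
  exact ((transvection_inl_congruent hB hspan h2 ha hb hc).mul
    (transvection_inr_congruent hB h2 hp hc)).mul
    (transvection_inl_inr_congruent hB h2 ha hb (smul_sub_smul_mem hc hp))

/-! ### The main inclusion. -/

theorem relTransSp_le_relElemTransSp (hB : B.IsAlt)
    (hspan : Ideal.span (Set.range fun x : P × P => B x.1 x.2) = ⊤) (h2 : IsUnit (2 : R)) :
    relTransSp (formQ B) I ≤ relElemTransSp B I := by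
  have hQ := formQ_isAlt hB
  obtain ⟨h, h2⟩ := h2.exists_right_inv
  refine (Subgroup.closure_le _).2 ?_
  rintro σ ⟨u, v, α, hv, hα, hσ⟩
  obtain ⟨huv, rfl⟩ := (isTransvectionOf_iff hQ).1 hσ
  -- The right-hand sides are the three polarization factors; the left-hand sides, with parameters
  -- `h`, `-h`, `0` along `u`, multiply to 1.
  have h1 := transvection_congruent hB hspan h2 (w := u) (w' := u + v) (c := h) (c' := h)
    (by simpa using neg_mem hv) (by simp)
  have h3 := transvection_congruent hB hspan h2 (w := u) (w' := u - v) (c := -h) (c' := -h)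
    (by simpa using hv) (by simp)
  have h4 := transvection_congruent hB hspan h2 (w := u) (w' := u) (c := 0) (c' := α)
    (by simp) (by simpa using neg_mem hα)
  have := (h1.mul h3).mul h4
  rw [← transvection_polarization hQ huv α h2, transvection_mul,
    transvection_mul] at this
  simpa [transvection_zero] using (elemCongr_iff.1 this).2

end HyperbolicSum

end SymplecticTransvection

theorem mainTheorem2 {R : Type*} [CommRing R] (h2 : IsUnit (2 : R)) (I : Ideal R)
    {P : Type*} [AddCommGroup P] [Module R P] [Module.Finite R P] [Module.Projective R P]
    (n : ℕ) (hn : 1 ≤ n)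
    (hrank : ∀ 𝔭 : PrimeSpectrum R, Module.rankAtStalk (R := R) P 𝔭 = 2 * n)
    (B : LinearMap.BilinForm R P) (hB : SymplecticTransvection.IsSymplecticForm B)
    (hloc : SymplecticTransvection.LocallyCongruentToStandard B n I) :
    SymplecticTransvection.relTransSp (SymplecticTransvection.formQ B) I =
      SymplecticTransvection.relElemTransSp B I := by
  have hpos (𝔭 : PrimeSpectrum R) : 0 < Module.rankAtStalk (R := R) P 𝔭 := by
    rw [hrank]
    omega
  exact le_antisymm
    (SymplecticTransvection.relTransSp_le_relElemTransSp hB.isAlt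
      (SymplecticTransvection.span_range_form_eq_top hpos hB.bijective.surjective) h2)
    (SymplecticTransvection.relElemTransSp_le_relTransSp hB.isAlt I)
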